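/- Consider $N$ players with parameters $\lambda_j>0$, $\gamma_j>0$, $p_j>0$ ($1\le j\le N$) and acceleration bounds $1\le u_{\min}<u_{\max}<\infty$. Let $\mathcal U$ be the set of piecewise continuous functions $u:[0,\infty)\to[u_{\min},u_{\max}]$ (finitely many discontinuities in every bounded interval, with finite one-sided limits). For a profile $\mathbf u=(u_1,\dots,u_N)\in\mathcal U^N$ and an initial state $z=(z_1,\dots,z_N)$ with $z_j\ge 0$ and $\sum_j z_j\le 1$, let $x_1,\dots,x_N$ be the unique continuous solution on $[0,\infty)$ of $$\dot x_j(t)=\lambda_j u_j(t)\bigl(1-x(t)\bigr),\qquad x=\sum_{k=1}^N x_k,\qquad x_j(0)=z_j ,$$ (the equation being required at all times $t>0$ at which all the controls are continuous), and let the discounted infinite-horizon cost of player $i$ be $$J_i(z,\mathbf u)=\int_0^\infty e^{-p_i s}\bigl(-\dot x_i(s)+\gamma_i\,(u_i(s)-u_{\min})\bigr)\,ds .$$ Fix a player $i$, strategies $\mathbf u_{-i}=(u_j)_{j\ne i}$ of the other players, with $u_j\in\mathcal U$, and an initial state $z$ as above, and let $$V_i(z)=\inf_{v\in\mathcal U}J_i\bigl(z,(v,\mathbf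 u_{-i})\bigr)$$ be the value function. Then the integral defining $J_i(z,(v,\mathbf u_{-i}))$ converges absolutely for every $v\in\mathcal U$, and $V_i(z)$ is attained by a bang-bang strategy: there is $w\in\mathcal U$ with $w(t)\in\{u_{\min},u_{\max}\}$ for all $t\ge 0$ such that $$J_i\bigl(z,(w,\mathbf u_{-i})\bigr)=V_i(z)\le J_i\bigl(z,(v,\mathbf u_{-i})\bigr)\qquad\text{for all } v\in\mathcal U .$$ -/

import Mathlib

open MeasureTheory Set Filter Topology

/-- The data of the content diffusion game with `N` players. -/
structure ContentGame (N : ℕ) where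
  /-- intensity of views of each content -/
  lam : Fin N → ℝ
  /-- unit cost of acceleration of each player -/
  gam : Fin N → ℝ
  /-- discount factor of each player -/
  p : Fin N → ℝ
  /-- minimal acceleration -/
  umin : ℝ
  /-- maximal acceleration -/
  umax : ℝ
  lam_pos : ∀ i, 0 < lam i
  gam_pos : ∀ i, 0 < gam i
  p_pos : ∀ i, 0 < p i
  one_le_umin : 1 ≤ umin
  umin_lt_umax : umin < umax

/-- Piecewise continuity on `[0, ∞)`: finitely many discontinuities in every bounded interval,
and finite one-sided limits everywhere. Values at negative times are irrelevant. -/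
def PiecewiseContinuous (u : ℝ → ℝ) : Prop :=
  (∀ T : ℝ, {t | t ∈ Ioo 0 T ∧ ¬ ContinuousAt u t}.Finite) ∧
  (∀ t : ℝ, 0 ≤ t → ∃ l : ℝ, Tendsto u (𝓝[>] t) (𝓝 l)) ∧
  (∀ t : ℝ, 0 < t → ∃ l : ℝ, Tendsto u (𝓝[<] t) (𝓝 l))

namespace ContentGame

variable {N : ℕ}

/-- The strategy space: piecewise continuous controls `[0, ∞) → [umin, umax]`. -/
def strategies (g : ContentGame N) : Set (ℝ → ℝ) :=
  {u | PiecewiseContinuous u ∧ ∀ t : ℝ, 0 ≤ t → u t ∈ Icc g.umin g.umax}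

/-- A control is bang-bang if it takes only the values `umin` and `umax`. -/
def IsBangBang (g : ContentGame N) (u : ℝ → ℝ) : Prop :=
  ∀ t : ℝ, 0 ≤ t → u t = g.umin ∨ u t = g.umax

/-- The right-hand side `lam i * u i * (1 - x)` of the dynamics of content `i`, where `x` is the
sum of the fractions `ξ j`; `a` is the vector of accelerations in use. -/
def viewRate (g : ContentGame N) (a ξ : Fin N → ℝ) (i : Fin N) : ℝ :=
  g.lam i * a i * (1 - ∑ j, ξ j)

/-- `X` solves the system `X i' = lam i * u i * (1 - ∑ j, X j)`, `X i 0 = z i` on `[0, ∞)`: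
it is continuous and satisfies the differential equation at all times `t > 0` where
all the controls are continuous. -/
structure IsTrajectory (g : ContentGame N) (z : Fin N → ℝ) (u : Fin N → ℝ → ℝ)
    (X : Fin N → ℝ → ℝ) : Prop where
  continuousOn : ∀ i, ContinuousOn (X i) (Ici 0)
  initial : ∀ i, X i 0 = z i
  hasDerivAt : ∀ t : ℝ, 0 < t → (∀ j, ContinuousAt (u j) t) →
    ∀ i, HasDerivAt (X i) (g.viewRate (fun j => u j t) (fun j => X j t) i) t

theorem countable_disc {u : Fin N → ℝ → ℝ} (hu : ∀ j, PiecewiseContinuous (u j)) :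
    {t : ℝ | 0 < t ∧ ¬ ∀ j, ContinuousAt (u j) t}.Countable := by
  have h : {t : ℝ | 0 < t ∧ ¬ ∀ j, ContinuousAt (u j) t} ⊆
      ⋃ j : Fin N, ⋃ n : ℕ, {t | t ∈ Ioo (0 : ℝ) n ∧ ¬ ContinuousAt (u j) t} := by
    rintro t ⟨ht, hc⟩
    push Not at hc
    obtain ⟨j, hj⟩ := hc
    obtain ⟨n, hn⟩ := exists_nat_gt t
    simp only [mem_iUnion]
    exact ⟨j, n, ⟨ht, hn⟩, hj⟩
  refine Set.Countable.mono h ?_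
  exact Set.countable_iUnion fun j => Set.countable_iUnion fun n => ((hu j).1 n).countable

theorem eq_of_deriv_zero {f : ℝ → ℝ} {s : Set ℝ} (hs : s.Countable)
    (hf : ContinuousOn f (Ici 0)) (hd : ∀ t, 0 < t → t ∉ s → HasDerivAt f 0 t)
    {t : ℝ} (ht : 0 ≤ t) : f t = f 0 := by
  have := integral_eq_of_hasDerivAt_off_countable_of_le f (fun _ => 0) ht hs
    (hf.mono Icc_subset_Ici_self) (fun x hx => hd x hx.1.1 hx.2) (by simp)
  simp at this
  linarith

theorem intervalIntegrable_of_strategy {g : ContentGame N} {u : ℝ → ℝ} (hu : u ∈ g.strategies)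
    {T : ℝ} (hT : 0 ≤ T) : IntervalIntegrable u volume 0 T := by
  rw [intervalIntegrable_iff_integrableOn_Ioo_of_le hT]
  have hfin := hu.1.1 T
  set S := {t | t ∈ Ioo 0 T ∧ ¬ ContinuousAt u t}
  have hae : (Ioo 0 T \ S : Set ℝ) =ᵐ[volume] Ioo 0 T :=
    sdiff_null_ae_eq_self (hfin.measure_zero _)
  have hm : AEStronglyMeasurable u (volume.restrict (Ioo 0 T)) := by
    rw [← Measure.restrict_congr_set hae]
    refine ContinuousOn.aestronglyMeasurable (fun t ht => ?_)
      (measurableSet_Ioo.diff hfin.measurableSet)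
    have : ContinuousAt u t := by
      by_contra h
      exact ht.2 ⟨ht.1, h⟩
    exact this.continuousWithinAt
  refine IntegrableOn.of_bound (by simp) hm (max |g.umin| |g.umax|) ?_
  filter_upwards [ae_restrict_mem measurableSet_Ioo] with t ht
  have := hu.2 t ht.1.le
  exact abs_le_max_abs_abs this.1 this.2

theorem hasDerivAt_integral_of_continuousAt {f : ℝ → ℝ}
    (hf : ∀ T : ℝ, 0 ≤ T → IntervalIntegrable f volume 0 T) {t : ℝ} (ht : 0 < t)
    (hc : ContinuousAt f t) : HasDerivAt (fun r => ∫ s in (0 : ℝ)..r, f s) (f t) t := by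
  refine intervalIntegral.integral_hasDerivAt_right (hf t ht.le) ?_ hc
  refine ⟨Ioo 0 (t + 1), Ioo_mem_nhds ht (by linarith), ?_⟩
  have := (hf (t + 1) (by linarith)).1.aestronglyMeasurable
  exact this.mono_set Ioo_subset_Ioc_self

theorem continuousOn_integral {f : ℝ → ℝ}
    (hf : ∀ T : ℝ, 0 ≤ T → IntervalIntegrable f volume 0 T) :
    ContinuousOn (fun r => ∫ s in (0 : ℝ)..r, f s) (Ici 0) := by
  intro t ht
  have ht' : (0 : ℝ) ≤ t := ht
  have h := intervalIntegral.continuousOn_primitive_interval' (hf (t + 1) (by linarith))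
    left_mem_uIcc t (by rw [uIcc_of_le (by linarith)]; exact ⟨ht', by linarith⟩)
  rw [uIcc_of_le (by linarith)] at h
  refine h.mono_of_mem_nhdsWithin ?_
  rw [← Ici_inter_Iic]
  exact inter_mem self_mem_nhdsWithin (mem_nhdsWithin_of_mem_nhds (Iic_mem_nhds (by linarith)))

/-- Any strategy profile has a trajectory from any initial state. -/
theorem exists_isTrajectory (g : ContentGame N) (z : Fin N → ℝ) {u : Fin N → ℝ → ℝ}
    (hu : ∀ j, u j ∈ g.strategies) : ∃ X, g.IsTrajectory z u X := by
  set a : ℝ → ℝ := fun t => ∑ j, g.lam j * u j t with ha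
  have haI : ∀ T : ℝ, 0 ≤ T → IntervalIntegrable a volume 0 T := fun T hT => by
    have := IntervalIntegrable.sum (μ := volume) (a := 0) (b := T) Finset.univ
      (f := fun j t => g.lam j * u j t)
      (fun j _ => (intervalIntegrable_of_strategy (hu j) hT).const_mul (g.lam j))
    have hs : a = ∑ j, fun t => g.lam j * u j t := by
      funext t
      simp [ha]
    rwa [hs]
  have hAc := continuousOn_integral haI
  set y : ℝ → ℝ := fun t => (1 - ∑ j, z j) * Real.exp (-∫ s in (0 : ℝ)..t, a s) with hy
  have hyc : ContinuousOn y (Ici 0) := continuousOn_const.mul hAc.neg.rexp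
  have hI : ∀ j, ∀ T : ℝ, 0 ≤ T →
      IntervalIntegrable (fun s => g.lam j * u j s * y s) volume 0 T := fun j T hT => by
    refine ((intervalIntegrable_of_strategy (hu j) hT).const_mul (g.lam j)).mul_continuousOn ?_
    rw [uIcc_of_le hT]
    exact hyc.mono Icc_subset_Ici_self
  have hyd : ∀ t, 0 < t → (∀ j, ContinuousAt (u j) t) → HasDerivAt y (-(a t * y t)) t := by
    intro t ht hc
    have hca : ContinuousAt a t := by
      simp only [ha]
      exact tendsto_finsetSum _ fun j _ => (hc j).const_mul _
    have := ((hasDerivAt_integral_of_continuousAt haI ht hca).neg.exp).const_mul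
      (1 - ∑ j, z j)
    refine this.congr_deriv ?_
    simp only [hy, Pi.neg_apply]
    ring
  set X : Fin N → ℝ → ℝ := fun j t => z j + ∫ s in (0 : ℝ)..t, g.lam j * u j s * y s with hX
  have hXc : ∀ j, ContinuousOn (X j) (Ici 0) := fun j =>
    continuousOn_const.add (continuousOn_integral (hI j))
  have hXd : ∀ t, 0 < t → (∀ j, ContinuousAt (u j) t) →
      ∀ i, HasDerivAt (X i) (g.lam i * u i t * y t) t := by
    intro t ht hc i
    have hcy : ContinuousAt y t := (hyd t ht hc).continuousAt
    exact (hasDerivAt_integral_of_continuousAt (hI i) ht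
      (((hc i).const_mul _).mul hcy)).const_add _
  have hsum : ∀ t, 0 ≤ t → 1 - ∑ j, X j t = y t := by
    intro t ht
    have h := eq_of_deriv_zero (f := fun t => y t + ∑ j, X j t)
      (countable_disc fun j => (hu j).1)
      (hyc.add (continuousOn_finsetSum _ fun j _ => hXc j)) (fun t ht hs => by
        have hc : ∀ j, ContinuousAt (u j) t := by
          by_contra h
          exact hs ⟨ht, h⟩
        have h1 := (hyd t ht hc).add (HasDerivAt.fun_sum fun j (_ : j ∈ Finset.univ) =>
          hXd t ht hc j)
        refine h1.congr_deriv ?_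
        rw [← Finset.sum_mul]
        ring) ht
    simp only [hX, hy, intervalIntegral.integral_same] at h ⊢
    simp at h
    linarith
  refine ⟨X, hXc, fun i => by simp [hX], fun t ht hc i => ?_⟩
  have := hXd t ht hc i
  rwa [← hsum t ht.le] at this

/-- The trajectory is unique on `[0, ∞)`. -/
theorem IsTrajectory.unique {g : ContentGame N} {z : Fin N → ℝ} {u X Y : Fin N → ℝ → ℝ}
    (hu : ∀ j, u j ∈ g.strategies) (hX : g.IsTrajectory z u X) (hY : g.IsTrajectory z u Y)
    (i : Fin N) {t : ℝ} (ht : 0 ≤ t) : X i t = Y i t := by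
  set a : ℝ → ℝ := fun t => ∑ j, g.lam j * u j t with ha
  have haI : ∀ T : ℝ, 0 ≤ T → IntervalIntegrable a volume 0 T := fun T hT => by
    have := IntervalIntegrable.sum (μ := volume) (a := 0) (b := T) Finset.univ
      (f := fun j t => g.lam j * u j t)
      (fun j _ => (intervalIntegrable_of_strategy (hu j) hT).const_mul (g.lam j))
    have hs : a = ∑ j, fun t => g.lam j * u j t := by
      funext t
      simp [ha]
    rwa [hs]
  have hdisc := countable_disc fun j => (hu j).1
  have hsum : ∀ t, 0 ≤ t → ∑ j, X j t - ∑ j, Y j t = 0 := by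
    intro t ht
    have h := eq_of_deriv_zero
      (f := fun t => (∑ j, X j t - ∑ j, Y j t) * Real.exp (∫ s in (0 : ℝ)..t, a s))
      hdisc
      (((continuousOn_finsetSum _ fun j _ => hX.continuousOn j).sub
        (continuousOn_finsetSum _ fun j _ => hY.continuousOn j)).mul
        (continuousOn_integral haI).rexp) (fun t ht hs => by
        have hc : ∀ j, ContinuousAt (u j) t := by
          by_contra h
          exact hs ⟨ht, h⟩
        have hca : ContinuousAt a t := by
          simp only [ha]
          exact tendsto_finsetSum _ fun j _ => (hc j).const_mul _
        have h1 := ((HasDerivAt.fun_sum fun j (_ : j ∈ Finset.univ) =>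
          hX.hasDerivAt t ht hc j).sub (HasDerivAt.fun_sum fun j (_ : j ∈ Finset.univ) =>
          hY.hasDerivAt t ht hc j)).mul (hasDerivAt_integral_of_continuousAt haI ht hca).exp
        refine h1.congr_deriv ?_
        simp only [viewRate, ← Finset.sum_mul, ha, Pi.sub_apply]
        ring) ht
    simpa [hX.initial, hY.initial, Real.exp_ne_zero] using h
  have h := eq_of_deriv_zero (f := fun t => X i t - Y i t) hdisc
    ((hX.continuousOn i).sub (hY.continuousOn i)) (fun t ht hs => by
      have hc : ∀ j, ContinuousAt (u j) t := by
        by_contra h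
        exact hs ⟨ht, h⟩
      refine ((hX.hasDerivAt t ht hc i).sub (hY.hasDerivAt t ht hc i)).congr_deriv ?_
      simp only [viewRate]
      rw [← mul_sub]
      have := hsum t ht.le
      rw [show (1 - ∑ j, X j t - (1 - ∑ j, Y j t)) = 0 by linarith, mul_zero]) ht
  simp only [hX.initial, hY.initial] at h
  linarith

open Classical in
/-- The trajectory of the strategy profile `u` from the initial state `z`; for strategy profiles
it exists and is unique on `[0, ∞)`, by the two preceding theorems. -/
noncomputable def trajectory (g : ContentGame N) (z : Fin N → ℝ) (u : Fin N → ℝ → ℝ) :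
    Fin N → ℝ → ℝ :=
  if h : ∃ X, g.IsTrajectory z u X then h.choose else fun i _ => z i

theorem isTrajectory_trajectory (g : ContentGame N) (z : Fin N → ℝ) {u : Fin N → ℝ → ℝ}
    (hu : ∀ j, u j ∈ g.strategies) : g.IsTrajectory z u (g.trajectory z u) := by
  have h := g.exists_isTrajectory z hu
  rw [trajectory, dif_pos h]
  exact h.choose_spec

/-- The discounted running cost of player `i` at time `s`,
`exp (-p i * s) * (- X i' s + gam i * (u i s - umin))`, where the speed `X i'` is given by the
right-hand side of the dynamics. -/
noncomputable def discountedRunningCost (g : ContentGame N) (i : Fin N) (z : Fin N → ℝ)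
    (u : Fin N → ℝ → ℝ) (s : ℝ) : ℝ :=
  Real.exp (-(g.p i * s)) *
    (-g.viewRate (fun j => u j s) (fun j => g.trajectory z u j s) i
      + g.gam i * (u i s - g.umin))

/-- The infinite-horizon discounted cost of player `i` under the profile `u`. -/
noncomputable def cost (g : ContentGame N) (i : Fin N) (z : Fin N → ℝ) (u : Fin N → ℝ → ℝ) : ℝ :=
  ∫ s in Ioi (0 : ℝ), g.discountedRunningCost i z u s

/-- The value function of player `i`: the infimum of the costs over all strategies `v` of
player `i`, the other players using their components of `u` (the component `u i` is ignored). -/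
noncomputable def value (g : ContentGame N) (i : Fin N) (u : Fin N → ℝ → ℝ) (z : Fin N → ℝ) : ℝ :=
  sInf ((fun v => g.cost i z (Function.update u i v)) '' g.strategies)

end ContentGame

/-!
Against fixed opponents, the remaining audience `y = 1 - ∑ j, X j` of player `i` obeys the scalar
equation `y' = -(l * v + b) * y`, where `b ≥ 0` is the total intensity of the opponents. Hence
`y = y0 * exp (-(l * V + B))` with the primitives `V`, `B` of `v`, `b`, and the cost depends on the
opponents through `b` alone (`ContentGame.discountedRunningCost_eq`).

Written in terms of `V`, the problem is convex. Integrating `-(l * v * y) = y' + b * y` by parts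
turns the cost into a boundary term plus the integral of `exp (-p s)` times the sum of
`(p + b) * y`, which is convex in `V`, and a term that is affine in `V`. Comparing an arbitrary
control `v` with a candidate `w` therefore gives
`J v - J w ≥ ∫ σ * (v - w)`, where `σ` is the switching function along `w`, namely
`σ t = exp (-p t) * (γ - l * y t) + l ^ 2 * ∫ s in Ioi t, exp (-p s) * w s * y s`.
So `w` is optimal as soon as `w` is maximal where `σ < 0` and minimal where `σ > 0`
(`ScalarProblem.integral_runCost_le`).

There is no singular arc, however irregular `b` is. Where `l * y ≤ γ`, the switching function is
nonnegative by its formula. Where `l * y ≥ γ`, which is an initial time interval as `y` decreases,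
its derivative `exp (-p t) * (l * y * (p + b) - p * γ)` is nonnegative. Thus `σ` changes sign at
most once, from negative to positive, and the control should be maximal before some time `τ` and
minimal afterwards. A consistent `τ` is one at which the switching function along the control with
switching time `τ` vanishes; it is found with the intermediate value theorem
(`ScalarProblem.exists_switching_bang`), unless `τ = 0` already works.
-/

/-! ### Regular functions on the half-line -/

/-- A function that is locally bounded on `[0, ∞)` and continuous at all but countably many points
of `(0, ∞)`. This class contains the strategies and all functions continuous on `[0, ∞)`, is closed
under products, and is covered by the fundamental theorem of calculus off countable sets. -/
structure Regular (f : ℝ → ℝ) : Prop where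
  countable : {t : ℝ | 0 < t ∧ ¬ ContinuousAt f t}.Countable
  bounded : ∀ T : ℝ, ∃ C : ℝ, ∀ t ∈ Icc 0 T, |f t| ≤ C

theorem ContinuousOn.regular {f : ℝ → ℝ} (hf : ContinuousOn f (Ici 0)) : Regular f where
  countable := by
    convert countable_empty
    ext t
    simp only [mem_ofPred_eq, mem_empty_iff_false, iff_false, not_and, not_not]
    exact fun ht => hf.continuousAt (Ici_mem_nhds ht)
  bounded T := by
    obtain ⟨C, hC⟩ := isCompact_Icc.exists_bound_of_continuousOn
      (hf.mono (Icc_subset_Ici_self : Icc 0 T ⊆ Ici 0))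
    exact ⟨C, hC⟩

namespace Regular

variable {f h : ℝ → ℝ}

theorem const (c : ℝ) : Regular fun _ => c := continuousOn_const.regular

theorem add (hf : Regular f) (hh : Regular h) : Regular fun t => f t + h t where
  countable := by
    refine (hf.countable.union hh.countable).mono ?_
    rintro t ⟨ht, hc⟩
    by_contra hn
    simp only [mem_union, mem_ofPred_eq, ht, true_and, not_or, not_not] at hn
    exact hc (hn.1.add hn.2)
  bounded T := by
    obtain ⟨C, hC⟩ := hf.bounded T
    obtain ⟨C', hC'⟩ := hh.bounded T
    exact ⟨C + C', fun t ht => (abs_add_le _ _).trans (add_le_add (hC t ht) (hC' t ht))⟩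

theorem mul (hf : Regular f) (hh : Regular h) : Regular fun t => f t * h t where
  countable := by
    refine (hf.countable.union hh.countable).mono ?_
    rintro t ⟨ht, hc⟩
    by_contra hn
    simp only [mem_union, mem_ofPred_eq, ht, true_and, not_or, not_not] at hn
    exact hc (hn.1.mul hn.2)
  bounded T := by
    obtain ⟨C, hC⟩ := hf.bounded T
    obtain ⟨C', hC'⟩ := hh.bounded T
    refine ⟨C * C', fun t ht => ?_⟩
    rw [abs_mul]
    exact mul_le_mul (hC t ht) (hC' t ht) (abs_nonneg _) ((abs_nonneg _).trans (hC t ht))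

theorem const_mul (hf : Regular f) (c : ℝ) : Regular fun t => c * f t := (const c).mul hf

theorem sub (hf : Regular f) (hh : Regular h) : Regular fun t => f t - h t := by
  simpa [sub_eq_add_neg] using hf.add (hh.const_mul (-1))

theorem sum {ι : Type*} (s : Finset ι) {F : ι → ℝ → ℝ} (hF : ∀ j ∈ s, Regular (F j)) :
    Regular fun t => ∑ j ∈ s, F j t := by
  classical
  induction s using Finset.induction_on with
  | empty => simpa using const 0
  | insert a s ha ih =>
    simp only [Finset.sum_insert ha]
    exact (hF a (by simp)).add (ih fun j hj => hF j (by simp [hj]))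

theorem aestronglyMeasurable (hf : Regular f) :
    AEStronglyMeasurable f (volume.restrict (Ioi 0)) := by
  set S := {t : ℝ | 0 < t ∧ ¬ ContinuousAt f t}
  have hae : (Ioi 0 \ S : Set ℝ) =ᵐ[volume] Ioi 0 :=
    sdiff_null_ae_eq_self (hf.countable.measure_zero _)
  rw [← Measure.restrict_congr_set hae]
  refine ContinuousOn.aestronglyMeasurable (fun t ht => ?_)
    (measurableSet_Ioi.diff hf.countable.measurableSet)
  have : ContinuousAt f t := by
    by_contra hn
    exact ht.2 ⟨ht.1, hn⟩
  exact this.continuousWithinAt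

theorem intervalIntegrable_zero (hf : Regular f) {T : ℝ} (hT : 0 ≤ T) :
    IntervalIntegrable f volume 0 T := by
  rw [intervalIntegrable_iff_integrableOn_Ioc_of_le hT]
  obtain ⟨C, hC⟩ := hf.bounded T
  refine IntegrableOn.of_bound (by simp) (hf.aestronglyMeasurable.mono_set Ioc_subset_Ioi_self) C ?_
  filter_upwards [ae_restrict_mem measurableSet_Ioc] with t ht
  exact hC t ⟨ht.1.le, ht.2⟩

theorem intervalIntegrable (hf : Regular f) {a b : ℝ} (ha : 0 ≤ a) (hb : 0 ≤ b) :
    IntervalIntegrable f volume a b :=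
  (hf.intervalIntegrable_zero ha).symm.trans (hf.intervalIntegrable_zero hb)

theorem integrableOn_Ioi (hf : Regular f) {C p : ℝ} (hp : 0 < p)
    (hC : ∀ t, 0 < t → |f t| ≤ C * Real.exp (-p * t)) : IntegrableOn f (Ioi 0) := by
  refine Integrable.mono' ((exp_neg_integrableOn_Ioi 0 hp).const_mul C) hf.aestronglyMeasurable ?_
  filter_upwards [ae_restrict_mem measurableSet_Ioi] with t ht
  exact hC t ht

theorem continuousOn_primitive (hf : Regular f) :
    ContinuousOn (fun r => ∫ s in (0 : ℝ)..r, f s) (Ici 0) :=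
  ContentGame.continuousOn_integral fun _ => hf.intervalIntegrable_zero

theorem hasDerivAt_primitive (hf : Regular f) {t : ℝ} (ht : 0 < t) (hc : ContinuousAt f t) :
    HasDerivAt (fun r => ∫ s in (0 : ℝ)..r, f s) (f t) t :=
  ContentGame.hasDerivAt_integral_of_continuousAt (fun _ => hf.intervalIntegrable_zero) ht hc

/-- The fundamental theorem of calculus for a continuous function whose derivative, off a countable
set, is a regular function. -/
theorem integral_eq_sub {F : ℝ → ℝ} (hf : Regular f) (hF : ContinuousOn F (Ici 0))
    {S : Set ℝ} (hS : S.Countable) (hd : ∀ t, 0 < t → t ∉ S → HasDerivAt F (f t) t)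
    {a b : ℝ} (ha : 0 ≤ a) (hab : a ≤ b) : ∫ s in a..b, f s = F b - F a :=
  integral_eq_of_hasDerivAt_off_countable_of_le F f hab hS
    (hF.mono fun _ hx => ha.trans hx.1) (fun t ht => hd t (ha.trans_lt ht.1.1) ht.2)
    (hf.intervalIntegrable ha (ha.trans hab))

end Regular

theorem ContentGame.regular_of_mem_strategies {N : ℕ} {g : ContentGame N} {v : ℝ → ℝ}
    (hv : v ∈ g.strategies) : Regular v where
  countable := by
    have := countable_disc (u := fun _ : Fin 1 => v) fun _ => hv.1
    simpa using this
  bounded _ := ⟨max |g.umin| |g.umax|, fun t ht =>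
    abs_le_max_abs_abs (hv.2 t ht.1).1 (hv.2 t ht.1).2⟩

/-! ### The scalar control problem of one player -/

/-- The control problem of one player against fixed opponents: the remaining audience `y` obeys
`y' = -(l * v + b) * y`, `y 0 = y0`, where `v` with values in `[m, M]` is the player's control and
`b ≥ 0` the total intensity of the opponents. -/
structure ScalarProblem where
  /-- discount factor -/
  p : ℝ
  /-- intensity of views of the player's content -/
  l : ℝ
  /-- unit cost of acceleration -/
  γ : ℝ
  /-- minimal acceleration -/
  m : ℝ
  /-- maximal acceleration -/
  M : ℝ
  /-- initial remaining audience -/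
  y0 : ℝ
  /-- total intensity of the opponents -/
  b : ℝ → ℝ
  p_pos : 0 < p
  l_pos : 0 < l
  γ_pos : 0 < γ
  m_pos : 0 < m
  m_lt_M : m < M
  y0_nonneg : 0 ≤ y0
  regular_b : Regular b
  b_nonneg : ∀ t, 0 ≤ t → 0 ≤ b t

namespace ScalarProblem

/-- The remaining audience under the control `v`, in closed form. -/
noncomputable def rest (P : ScalarProblem) (v : ℝ → ℝ) (t : ℝ) : ℝ :=
  P.y0 * Real.exp (-(P.l * (∫ s in (0 : ℝ)..t, v s) + ∫ s in (0 : ℝ)..t, P.b s))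

/-- The discounted running cost under the control `v`. -/
noncomputable def runCost (P : ScalarProblem) (v : ℝ → ℝ) (s : ℝ) : ℝ :=
  Real.exp (-P.p * s) * (-(P.l * v s * P.rest v s) + P.γ * (v s - P.m))

/-- The discounted flow of views `exp (-p s) * v s * y s`, up to the factor `l`. -/
noncomputable def flow (P : ScalarProblem) (v : ℝ → ℝ) (s : ℝ) : ℝ :=
  Real.exp (-P.p * s) * (v s * P.rest v s)

/-- The switching function along the control `v`: the derivative of the total cost with respect to
the control at time `t`. The integral accounts for the views lost after time `t` because the
audience reached at time `t` is no longer available. -/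
noncomputable def switching (P : ScalarProblem) (v : ℝ → ℝ) (t : ℝ) : ℝ :=
  Real.exp (-P.p * t) * (P.γ - P.l * P.rest v t) + P.l ^ 2 * ∫ s in Ioi t, P.flow v s

/-- The derivative of the switching function. It does not depend explicitly on the control. -/
noncomputable def switchingDeriv (P : ScalarProblem) (v : ℝ → ℝ) (t : ℝ) : ℝ :=
  Real.exp (-P.p * t) * (P.l * P.rest v t * (P.p + P.b t) - P.p * P.γ)

/-- Admissible controls of the scalar problem. -/
structure Admissible (P : ScalarProblem) (v : ℝ → ℝ) : Prop where
  regular : Regular v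
  mem_Icc : ∀ t, 0 ≤ t → v t ∈ Icc P.m P.M

variable {P : ScalarProblem} {v w : ℝ → ℝ}

theorem Admissible.nonneg (hv : P.Admissible v) {t : ℝ} (ht : 0 ≤ t) : 0 ≤ v t :=
  P.m_pos.le.trans (hv.mem_Icc t ht).1

theorem rest_zero (P : ScalarProblem) (v : ℝ → ℝ) : P.rest v 0 = P.y0 := by simp [rest]

theorem rest_nonneg (P : ScalarProblem) (v : ℝ → ℝ) (t : ℝ) : 0 ≤ P.rest v t :=
  mul_nonneg P.y0_nonneg (Real.exp_pos _).le

theorem regular_exp (p : ℝ) : Regular fun t => Real.exp (-p * t) :=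
  Continuous.continuousOn (by fun_prop) |>.regular

theorem continuousOn_rest (hv : Regular v) : ContinuousOn (P.rest v) (Ici 0) :=
  continuousOn_const.mul
    ((continuousOn_const.mul hv.continuousOn_primitive).add
      P.regular_b.continuousOn_primitive).neg.rexp

theorem hasDerivAt_rest (hv : Regular v) {t : ℝ} (ht : 0 < t) (hvc : ContinuousAt v t)
    (hbc : ContinuousAt P.b t) :
    HasDerivAt (P.rest v) (-(P.l * v t + P.b t) * P.rest v t) t := by
  have := (((hv.hasDerivAt_primitive ht hvc).const_mul P.l).add
    (P.regular_b.hasDerivAt_primitive ht hbc)).neg.exp.const_mul P.y0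
  refine this.congr_deriv ?_
  simp only [rest, Pi.neg_apply, Pi.add_apply]
  ring

theorem antitoneOn_rest (hv : P.Admissible v) : AntitoneOn (P.rest v) (Ici 0) := by
  intro a ha c hc hac
  have key : ∀ f : ℝ → ℝ, Regular f → (∀ t, 0 ≤ t → 0 ≤ f t) →
      ∫ s in (0 : ℝ)..a, f s ≤ ∫ s in (0 : ℝ)..c, f s := fun f hf h0 => by
    rw [← intervalIntegral.integral_add_adjacent_intervals (hf.intervalIntegrable le_rfl ha)
      (hf.intervalIntegrable ha hc)]
    have := intervalIntegral.integral_nonneg (μ := volume) hac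
      fun s hs => h0 s (le_trans ha hs.1)
    linarith
  refine mul_le_mul_of_nonneg_left (Real.exp_le_exp.2 (neg_le_neg ?_)) P.y0_nonneg
  exact add_le_add
    (mul_le_mul_of_nonneg_left (key v hv.regular fun t ht => hv.nonneg ht) P.l_pos.le)
    (key P.b P.regular_b P.b_nonneg)

theorem rest_le (hv : P.Admissible v) {t : ℝ} (ht : 0 ≤ t) : P.rest v t ≤ P.y0 := by
  rw [← P.rest_zero v]
  exact antitoneOn_rest hv self_mem_Ici ht ht

theorem regular_runCost (hv : Regular v) : Regular (P.runCost v) := by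
  have h := (regular_exp P.p).mul (((hv.sub (Regular.const P.m)).const_mul P.γ).sub
    ((hv.const_mul P.l).mul (continuousOn_rest (P := P) hv).regular))
  convert h using 2
  simp only [runCost]
  ring

theorem regular_flow (hv : Regular v) : Regular (P.flow v) :=
  (regular_exp P.p).mul (hv.mul (continuousOn_rest hv).regular)

theorem regular_switchingDeriv (hv : Regular v) : Regular (P.switchingDeriv v) :=
  (regular_exp P.p).mul ((((continuousOn_rest hv).regular.const_mul P.l).mul
    ((Regular.const P.p).add P.regular_b)).sub (Regular.const (P.p * P.γ)))

theorem integrableOn_runCost (hv : P.Admissible v) : IntegrableOn (P.runCost v) (Ioi 0) := by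
  refine (regular_runCost hv.regular).integrableOn_Ioi
    (C := P.l * P.M * P.y0 + P.γ * (P.M - P.m)) P.p_pos fun t ht => ?_
  have h1 := hv.mem_Icc t ht.le
  have hM : 0 ≤ P.M := P.m_pos.le.trans P.m_lt_M.le
  have h2 : P.l * v t * P.rest v t ≤ P.l * P.M * P.y0 :=
    mul_le_mul (mul_le_mul_of_nonneg_left h1.2 P.l_pos.le) (rest_le hv ht.le) (P.rest_nonneg v t)
      (mul_nonneg P.l_pos.le hM)
  have h3 : 0 ≤ P.l * v t * P.rest v t :=
    mul_nonneg (mul_nonneg P.l_pos.le (hv.nonneg ht.le)) (P.rest_nonneg v t)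
  have h4 : P.γ * (v t - P.m) ≤ P.γ * (P.M - P.m) :=
    mul_le_mul_of_nonneg_left (by linarith [h1.2]) P.γ_pos.le
  have h5 : 0 ≤ P.γ * (v t - P.m) := mul_nonneg P.γ_pos.le (by linarith [h1.1])
  rw [runCost, abs_mul, abs_of_pos (Real.exp_pos _), mul_comm]
  refine mul_le_mul_of_nonneg_right (abs_le.2 ⟨?_, ?_⟩) (Real.exp_pos _).le <;> linarith

theorem flow_nonneg (hv : P.Admissible v) {t : ℝ} (ht : 0 ≤ t) : 0 ≤ P.flow v t :=
  mul_nonneg (Real.exp_pos _).le (mul_nonneg (hv.nonneg ht) (P.rest_nonneg v t))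

theorem flow_le (hv : P.Admissible v) {t : ℝ} (ht : 0 ≤ t) :
    P.flow v t ≤ P.M * P.y0 * Real.exp (-P.p * t) := by
  rw [flow, mul_comm]
  exact mul_le_mul_of_nonneg_right (mul_le_mul (hv.mem_Icc t ht).2 (rest_le hv ht)
    (P.rest_nonneg v t) (P.m_pos.le.trans P.m_lt_M.le)) (Real.exp_pos _).le

theorem integrableOn_flow (hv : P.Admissible v) : IntegrableOn (P.flow v) (Ioi 0) :=
  (regular_flow hv.regular).integrableOn_Ioi P.p_pos fun t ht => by
    rw [abs_of_nonneg (flow_nonneg hv ht.le)]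
    exact flow_le hv ht.le

theorem integral_Ioi_flow_eq (hv : P.Admissible v) {t : ℝ} (ht : 0 ≤ t) :
    ∫ s in Ioi t, P.flow v s = (∫ s in Ioi 0, P.flow v s) - ∫ s in (0 : ℝ)..t, P.flow v s := by
  rw [← intervalIntegral.integral_Ioi_sub_Ioi (integrableOn_flow hv) ht]
  ring

theorem integral_Ioi_flow_nonneg (hv : P.Admissible v) {t : ℝ} (ht : 0 ≤ t) :
    0 ≤ ∫ s in Ioi t, P.flow v s :=
  setIntegral_nonneg measurableSet_Ioi fun _ hs => flow_nonneg hv (ht.trans (le_of_lt hs))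

theorem integral_Ioi_flow_le (hv : P.Admissible v) {t : ℝ} (ht : 0 ≤ t) :
    ∫ s in Ioi t, P.flow v s ≤ P.M * P.y0 * (Real.exp (-P.p * t) / P.p) := by
  have h : ∫ s in Ioi t, P.M * P.y0 * Real.exp (-P.p * s)
      = P.M * P.y0 * (Real.exp (-P.p * t) / P.p) := by
    rw [integral_const_mul, integral_exp_mul_Ioi (neg_neg_of_pos P.p_pos), neg_div_neg_eq]
  rw [← h]
  exact setIntegral_mono_on ((integrableOn_flow hv).mono_set (Ioi_subset_Ioi ht))
    ((exp_neg_integrableOn_Ioi t P.p_pos).const_mul _) measurableSet_Ioi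
    fun s hs => flow_le hv (ht.trans (le_of_lt hs))

/-! ### The switching function -/

theorem continuousOn_switching (hv : P.Admissible v) : ContinuousOn (P.switching v) (Ici 0) := by
  have h : ContinuousOn (fun t => Real.exp (-P.p * t) * (P.γ - P.l * P.rest v t)
      + P.l ^ 2 * ((∫ s in Ioi 0, P.flow v s) - ∫ s in (0 : ℝ)..t, P.flow v s)) (Ici 0) :=
    (ContinuousOn.mul (by fun_prop) (continuousOn_const.sub
      (continuousOn_const.mul (continuousOn_rest hv.regular)))).add
    (continuousOn_const.mul (continuousOn_const.sub
      (regular_flow hv.regular).continuousOn_primitive))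
  refine h.congr fun t ht => ?_
  rw [switching, integral_Ioi_flow_eq hv ht]

theorem hasDerivAt_switching (hv : P.Admissible v) {t : ℝ} (ht : 0 < t) (hvc : ContinuousAt v t)
    (hbc : ContinuousAt P.b t) : HasDerivAt (P.switching v) (P.switchingDeriv v t) t := by
  have hr := hasDerivAt_rest hv.regular ht hvc hbc
  have he : HasDerivAt (fun t => Real.exp (-P.p * t)) (Real.exp (-P.p * t) * (-P.p)) t := by
    simpa using ((hasDerivAt_id t).const_mul (-P.p)).exp
  have hfc : ContinuousAt (P.flow v) t := he.continuousAt.mul (hvc.mul hr.continuousAt)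
  have h := (he.mul ((hr.const_mul P.l).const_sub P.γ)).add
    ((((regular_flow hv.regular).hasDerivAt_primitive ht hfc).const_sub
      (∫ s in Ioi 0, P.flow v s)).const_mul (P.l ^ 2))
  refine (h.congr_deriv ?_).congr_of_eventuallyEq ?_
  · simp only [switchingDeriv, flow]
    ring
  · filter_upwards [Ioi_mem_nhds ht] with s hs
    rw [switching, integral_Ioi_flow_eq hv (le_of_lt hs)]
    rfl

theorem countable_not_continuousAt (hv : P.Admissible v) :
    {t : ℝ | 0 < t ∧ ¬ (ContinuousAt v t ∧ ContinuousAt P.b t)}.Countable := by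
  refine (hv.regular.countable.union P.regular_b.countable).mono ?_
  rintro t ⟨ht, hc⟩
  by_contra hn
  simp only [mem_union, mem_ofPred_eq, ht, true_and, not_or, not_not] at hn
  exact hc hn

theorem abs_switching_le (hv : P.Admissible v) {t : ℝ} (ht : 0 ≤ t) :
    |P.switching v t| ≤
      (P.γ + P.l * P.y0 + P.l ^ 2 * (P.M * P.y0 / P.p)) * Real.exp (-P.p * t) := by
  have h1 := integral_Ioi_flow_nonneg hv ht
  have h2 := mul_le_mul_of_nonneg_left (integral_Ioi_flow_le hv ht) (sq_nonneg P.l)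
  have h2' := mul_nonneg (sq_nonneg P.l) h1
  have h3 := mul_le_mul_of_nonneg_left (rest_le hv ht) P.l_pos.le
  have h4 := mul_nonneg P.l_pos.le (P.rest_nonneg v t)
  have he := Real.exp_pos (-P.p * t)
  have h5 : |P.γ - P.l * P.rest v t| ≤ P.γ + P.l * P.y0 := by
    have := P.γ_pos
    rw [abs_le]
    constructor <;> linarith
  calc |P.switching v t|
      ≤ |Real.exp (-P.p * t) * (P.γ - P.l * P.rest v t)|
        + |P.l ^ 2 * ∫ s in Ioi t, P.flow v s| := abs_add_le _ _
    _ ≤ Real.exp (-P.p * t) * (P.γ + P.l * P.y0)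
        + P.l ^ 2 * (P.M * P.y0 * (Real.exp (-P.p * t) / P.p)) := by
      rw [abs_mul, abs_of_pos he, abs_of_nonneg h2']
      exact add_le_add (mul_le_mul_of_nonneg_left h5 he.le) h2
    _ = _ := by ring

theorem switching_nonneg_of_rest_le (hv : P.Admissible v) {t : ℝ} (ht : 0 ≤ t)
    (h : P.l * P.rest v t ≤ P.γ) : 0 ≤ P.switching v t :=
  add_nonneg (mul_nonneg (Real.exp_pos _).le (sub_nonneg.2 h))
    (mul_nonneg (sq_nonneg _) (integral_Ioi_flow_nonneg hv ht))

/-- As long as the marginal gain `l * y` is at least `γ`, the switching function increases: there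
`l * y * (p + b) ≥ p * γ`, because `b ≥ 0`. -/
theorem switching_le_of_le_rest (hv : P.Admissible v) {a t : ℝ} (ha : 0 ≤ a) (hat : a ≤ t)
    (h : P.γ ≤ P.l * P.rest v t) : P.switching v a ≤ P.switching v t := by
  have hI := (regular_switchingDeriv hv.regular).integral_eq_sub (continuousOn_switching hv)
    (countable_not_continuousAt hv) (fun s hs hc => by
      have hc' : ContinuousAt v s ∧ ContinuousAt P.b s := by
        by_contra hn
        exact hc ⟨hs, hn⟩
      exact hasDerivAt_switching hv hs hc'.1 hc'.2) ha hat
  have hnn : 0 ≤ ∫ s in a..t, P.switchingDeriv v s := by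
    refine intervalIntegral.integral_nonneg hat fun s hs => ?_
    have hs0 : 0 ≤ s := ha.trans hs.1
    have h1 : P.γ ≤ P.l * P.rest v s := h.trans
      (mul_le_mul_of_nonneg_left (antitoneOn_rest hv hs0 (ha.trans hat) hs.2) P.l_pos.le)
    have h2 := P.b_nonneg s hs0
    have h3 := mul_le_mul h1 (le_add_of_nonneg_right h2 : P.p ≤ P.p + P.b s) P.p_pos.le
      (P.γ_pos.le.trans h1)
    exact mul_nonneg (Real.exp_pos _).le (by linarith)
  linarith

/-- The switching function changes sign at most once, from negative to positive. -/
theorem switching_nonneg_of_le (hv : P.Admissible v) {τ t : ℝ} (hτ : 0 ≤ τ) (ht : τ ≤ t)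
    (h : 0 ≤ P.switching v τ) : 0 ≤ P.switching v t := by
  rcases le_total (P.l * P.rest v t) P.γ with h1 | h1
  · exact switching_nonneg_of_rest_le hv (hτ.trans ht) h1
  · exact h.trans (switching_le_of_le_rest hv hτ ht h1)

/-- A zero of the switching function can only lie where `l * y ≥ γ`, since the integral in its
definition is nonnegative; hence the switching function is nonpositive before it. -/
theorem switching_nonpos_of_le (hv : P.Admissible v) {τ t : ℝ} (ht0 : 0 ≤ t) (ht : t ≤ τ)
    (h : P.switching v τ = 0) : P.switching v t ≤ 0 := by
  rw [← h]
  refine switching_le_of_le_rest hv ht0 ht ?_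
  by_contra hn
  have h1 := mul_pos (Real.exp_pos (-P.p * τ)) (sub_pos.2 (not_le.1 hn))
  have h2 := mul_nonneg (sq_nonneg P.l) (integral_Ioi_flow_nonneg hv (ht0.trans ht))
  rw [switching] at h
  linarith

/-! ### Sufficiency of the switching condition -/

/-- A potential for the comparison of the costs of `v` and `w`: its derivative is the difference of
their running costs, minus `switching * (v - w)` and a multiple of the convexity term. It vanishes
at time `0` and at infinity, so the difference of the total costs is the integral of those two
terms. -/
noncomputable def gap (P : ScalarProblem) (v w : ℝ → ℝ) (t : ℝ) : ℝ :=
  Real.exp (-P.p * t) * (P.rest v t - P.rest w t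
      + P.γ * ((∫ s in (0 : ℝ)..t, v s) - ∫ s in (0 : ℝ)..t, w s))
    - P.switching w t * ((∫ s in (0 : ℝ)..t, v s) - ∫ s in (0 : ℝ)..t, w s)

/-- The nonnegative convexity term in the comparison of two controls: the error in the
first-order expansion of the convex map `exp`. -/
noncomputable def convexityTerm (P : ScalarProblem) (v w : ℝ → ℝ) (t : ℝ) : ℝ :=
  P.rest v t - P.rest w t
    + P.l * ((∫ s in (0 : ℝ)..t, v s) - ∫ s in (0 : ℝ)..t, w s) * P.rest w t

theorem convexityTerm_nonneg (P : ScalarProblem) (v w : ℝ → ℝ) (t : ℝ) :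
    0 ≤ P.convexityTerm v w t := by
  set D := (∫ s in (0 : ℝ)..t, v s) - ∫ s in (0 : ℝ)..t, w s with hD
  have h1 : P.rest v t = P.rest w t * Real.exp (-(P.l * D)) := by
    rw [rest, rest, mul_assoc, ← Real.exp_add, hD]
    ring_nf
  have h2 : P.convexityTerm v w t = P.rest w t * (Real.exp (-(P.l * D)) - (-(P.l * D) + 1)) := by
    rw [convexityTerm, h1]
    ring
  rw [h2]
  exact mul_nonneg (P.rest_nonneg w t) (sub_nonneg.2 (Real.add_one_le_exp _))

theorem gap_zero (P : ScalarProblem) (v w : ℝ → ℝ) : P.gap v w 0 = 0 := by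
  simp [gap, rest_zero]

theorem continuousOn_gap (hv : P.Admissible v) (hw : P.Admissible w) :
    ContinuousOn (P.gap v w) (Ici 0) := by
  have hD := hv.regular.continuousOn_primitive.sub hw.regular.continuousOn_primitive
  exact (ContinuousOn.mul (by fun_prop) (((continuousOn_rest hv.regular).sub
    (continuousOn_rest hw.regular)).add (continuousOn_const.mul hD))).sub
    ((continuousOn_switching hw).mul hD)

theorem hasDerivAt_gap (hv : P.Admissible v) (hw : P.Admissible w) {t : ℝ} (ht : 0 < t)
    (hvc : ContinuousAt v t) (hwc : ContinuousAt w t) (hbc : ContinuousAt P.b t) :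
    HasDerivAt (P.gap v w) (P.runCost v t - P.runCost w t
      - (Real.exp (-P.p * t) * (P.p + P.b t) * P.convexityTerm v w t
        + P.switching w t * (v t - w t))) t := by
  have he : HasDerivAt (fun t => Real.exp (-P.p * t)) (Real.exp (-P.p * t) * (-P.p)) t := by
    simpa using ((hasDerivAt_id t).const_mul (-P.p)).exp
  have hD := (hv.regular.hasDerivAt_primitive ht hvc).sub (hw.regular.hasDerivAt_primitive ht hwc)
  have h := (he.mul (((hasDerivAt_rest hv.regular ht hvc hbc).sub
    (hasDerivAt_rest hw.regular ht hwc hbc)).add (hD.const_mul P.γ))).sub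
    ((hasDerivAt_switching hw ht hwc hbc).mul hD)
  refine h.congr_deriv ?_
  -- The flow terms combine through `-(l * v * y) = y' + b * y`.
  simp only [Pi.sub_apply, Pi.add_apply, runCost, convexityTerm, switchingDeriv]
  ring

theorem abs_integral_sub_le (hv : P.Admissible v) (hw : P.Admissible w) {t : ℝ} (ht : 0 ≤ t) :
    |(∫ s in (0 : ℝ)..t, v s) - ∫ s in (0 : ℝ)..t, w s| ≤ (P.M - P.m) * t := by
  rw [← intervalIntegral.integral_sub (hv.regular.intervalIntegrable_zero ht)
    (hw.regular.intervalIntegrable_zero ht)]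
  have := intervalIntegral.norm_integral_le_of_norm_le_const (a := 0) (b := t)
    (f := fun s => v s - w s) (C := P.M - P.m) fun s hs => by
      rw [uIoc_of_le ht] at hs
      have h1 := hv.mem_Icc s hs.1.le
      have h2 := hw.mem_Icc s hs.1.le
      rw [Real.norm_eq_abs, abs_le]
      constructor <;> linarith [h1.1, h1.2, h2.1, h2.2]
  rwa [sub_zero, abs_of_nonneg ht] at this

theorem tendsto_gap (hv : P.Admissible v) (hw : P.Admissible w) :
    Tendsto (P.gap v w) atTop (𝓝 0) := by
  -- `K` is the constant of `abs_switching_le`, so the gap is at most a multiple of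
  -- `(1 + t) * exp (-p * t)`.
  set K := P.γ + P.l * P.y0 + P.l ^ 2 * (P.M * P.y0 / P.p) with hK
  have h0 := (tendsto_rpow_mul_exp_neg_mul_atTop_nhds_zero 0 P.p P.p_pos).const_mul (P.y0)
  have h1 := (tendsto_rpow_mul_exp_neg_mul_atTop_nhds_zero 1 P.p P.p_pos).const_mul
    ((P.γ + K) * (P.M - P.m))
  have h2 := h0.add h1
  simp only [Real.rpow_zero, Real.rpow_one, one_mul, mul_zero, add_zero] at h2
  refine squeeze_zero_norm' ?_ h2
  filter_upwards [eventually_ge_atTop 0] with t ht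
  set D := (∫ s in (0 : ℝ)..t, v s) - ∫ s in (0 : ℝ)..t, w s with hD
  have hDle : |D| ≤ (P.M - P.m) * t := abs_integral_sub_le hv hw ht
  have he := Real.exp_pos (-P.p * t)
  have hr : |P.rest v t - P.rest w t| ≤ P.y0 := by
    rw [abs_le]
    constructor <;> linarith [rest_le hv ht, rest_le hw ht, P.rest_nonneg v t, P.rest_nonneg w t]
  have hσ := abs_switching_le hw ht
  have hγ : |P.γ * D| = P.γ * |D| := by rw [abs_mul, abs_of_pos P.γ_pos]
  have hK0 : 0 ≤ K * Real.exp (-P.p * t) := (abs_nonneg _).trans hσ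
  calc ‖P.gap v w t‖
      ≤ |Real.exp (-P.p * t) * (P.rest v t - P.rest w t + P.γ * D)| + |P.switching w t * D| :=
        abs_sub _ _
    _ ≤ Real.exp (-P.p * t) * (P.y0 + P.γ * |D|) + K * Real.exp (-P.p * t) * |D| := by
      rw [abs_mul, abs_mul, abs_of_pos he]
      refine add_le_add (mul_le_mul_of_nonneg_left ?_ he.le)
        (mul_le_mul_of_nonneg_right hσ (abs_nonneg _))
      rw [← hγ]
      exact (abs_add_le _ _).trans (add_le_add_left hr _)
    _ ≤ Real.exp (-P.p * t) * (P.y0 + P.γ * ((P.M - P.m) * t))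
        + K * Real.exp (-P.p * t) * ((P.M - P.m) * t) :=
      add_le_add (mul_le_mul_of_nonneg_left
        (add_le_add_right (mul_le_mul_of_nonneg_left hDle P.γ_pos.le) _) he.le)
        (mul_le_mul_of_nonneg_left hDle hK0)
    _ = _ := by ring

/-- A control `w` that satisfies the switching condition is optimal. -/
theorem integral_runCost_le (hv : P.Admissible v) (hw : P.Admissible w)
    (hσ : ∀ t, 0 ≤ t → 0 ≤ P.switching w t * (v t - w t)) :
    ∫ s in Ioi 0, P.runCost w s ≤ ∫ s in Ioi 0, P.runCost v s := by
  have hDc := hv.regular.continuousOn_primitive.sub hw.regular.continuousOn_primitive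
  have hreg1 := (regular_runCost (P := P) hv.regular).sub (regular_runCost (P := P) hw.regular)
  have hreg2 : Regular fun t => Real.exp (-P.p * t) * (P.p + P.b t) * P.convexityTerm v w t
      + P.switching w t * (v t - w t) :=
    (((regular_exp P.p).mul ((Regular.const P.p).add P.regular_b)).mul
      (((continuousOn_rest hv.regular).sub (continuousOn_rest hw.regular)).add
        ((continuousOn_const.mul hDc).mul (continuousOn_rest hw.regular))).regular).add
    ((continuousOn_switching hw).regular.mul (hv.regular.sub hw.regular))
  have hle : ∀ T, 0 ≤ T → P.gap v w T ≤ ∫ s in (0 : ℝ)..T, (P.runCost v s - P.runCost w s) := by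
    intro T hT
    have hI := (hreg1.sub hreg2).integral_eq_sub (continuousOn_gap hv hw)
      ((countable_not_continuousAt hv).union (countable_not_continuousAt hw)) (fun s hs hc => by
        have hc' : (ContinuousAt v s ∧ ContinuousAt P.b s) ∧
            (ContinuousAt w s ∧ ContinuousAt P.b s) := by
          by_contra hn
          refine hc ?_
          by_cases h1 : ContinuousAt v s ∧ ContinuousAt P.b s
          · exact Or.inr ⟨hs, fun h2 => hn ⟨h1, h2⟩⟩
          · exact Or.inl ⟨hs, h1⟩
        exact hasDerivAt_gap hv hw hs hc'.1.1 hc'.2.1 hc'.1.2) le_rfl hT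
    rw [gap_zero, sub_zero, intervalIntegral.integral_sub (hreg1.intervalIntegrable_zero hT)
      (hreg2.intervalIntegrable_zero hT)] at hI
    have hnn := intervalIntegral.integral_nonneg (μ := volume) hT fun s hs =>
      add_nonneg (mul_nonneg (mul_nonneg (Real.exp_pos (-P.p * s)).le
        (add_nonneg P.p_pos.le (P.b_nonneg s hs.1))) (P.convexityTerm_nonneg v w s)) (hσ s hs.1)
    linarith
  have hlim := intervalIntegral_tendsto_integral_Ioi 0
    ((integrableOn_runCost hv).sub (integrableOn_runCost hw)) tendsto_id
  have h := le_of_tendsto_of_tendsto (tendsto_gap hv hw) hlim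
    ((eventually_ge_atTop 0).mono hle)
  have hsub := integral_sub (integrableOn_runCost hv) (integrableOn_runCost hw)
  simp only [Pi.sub_apply] at h
  linarith

/-! ### The optimal bang-bang control -/

/-- The control that is maximal before time `τ` and minimal from `τ` on. -/
noncomputable def bang (P : ScalarProblem) (τ t : ℝ) : ℝ := if t < τ then P.M else P.m

theorem bang_of_lt {τ t : ℝ} (h : t < τ) : P.bang τ t = P.M := if_pos h

theorem bang_of_le {τ t : ℝ} (h : τ ≤ t) : P.bang τ t = P.m := if_neg h.not_gt

theorem continuousAt_bang {τ t : ℝ} (h : t ≠ τ) : ContinuousAt (P.bang τ) t := by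
  rcases h.lt_or_gt with h | h
  · exact continuousAt_const.congr
      (eventuallyEq_of_mem (Iio_mem_nhds h) fun s hs => (bang_of_lt hs).symm)
  · exact continuousAt_const.congr
      (eventuallyEq_of_mem (Ioi_mem_nhds h) fun s hs => (bang_of_le (le_of_lt hs)).symm)

theorem piecewiseContinuous_bang (P : ScalarProblem) (τ : ℝ) :
    PiecewiseContinuous (P.bang τ) := by
  refine ⟨fun T => (finite_singleton τ).subset fun t ht => ?_, fun t _ => ?_, fun t _ => ?_⟩
  · by_contra hn
    exact ht.2 (continuousAt_bang hn)
  · rcases lt_or_ge t τ with h | h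
    · exact ⟨_, (continuousAt_bang h.ne).continuousWithinAt.tendsto⟩
    · refine ⟨P.m, tendsto_const_nhds.congr' ?_⟩
      filter_upwards [self_mem_nhdsWithin] with s hs
      exact (bang_of_le (h.trans (le_of_lt hs))).symm
  · rcases le_or_gt t τ with h | h
    · refine ⟨P.M, tendsto_const_nhds.congr' ?_⟩
      filter_upwards [self_mem_nhdsWithin] with s hs
      exact (bang_of_lt (lt_of_lt_of_le hs h)).symm
    · exact ⟨_, (continuousAt_bang h.ne').continuousWithinAt.tendsto⟩

theorem bang_mem (P : ScalarProblem) (τ t : ℝ) : P.bang τ t ∈ Icc P.m P.M := by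
  have := P.m_lt_M.le
  rw [bang]
  split_ifs <;> constructor <;> linarith

theorem admissible_bang (P : ScalarProblem) (τ : ℝ) : P.Admissible (P.bang τ) where
  regular :=
    { countable := (countable_singleton τ).mono fun t ht => by
        by_contra hn
        exact ht.2 (continuousAt_bang hn)
      bounded := fun _ => ⟨max |P.m| |P.M|, fun t _ =>
        abs_le_max_abs_abs (P.bang_mem τ t).1 (P.bang_mem τ t).2⟩ }
  mem_Icc t _ := P.bang_mem τ t

theorem admissible_const {c : ℝ} (hc : c ∈ Icc P.m P.M) : P.Admissible fun _ => c where
  regular := Regular.const c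
  mem_Icc _ _ := hc

theorem integral_bang_self (P : ScalarProblem) {τ : ℝ} (hτ : 0 ≤ τ) :
    ∫ s in (0 : ℝ)..τ, P.bang τ s = P.M * τ := by
  have : ∫ s in (0 : ℝ)..τ, P.bang τ s = ∫ s in (0 : ℝ)..τ, P.M :=
    intervalIntegral.integral_congr_Ioo_of_le hτ fun s hs => bang_of_lt hs.2
  rw [this, intervalIntegral.integral_const, smul_eq_mul]
  ring

theorem integral_bang_of_le (P : ScalarProblem) {τ t : ℝ} (hτ : 0 ≤ τ) (ht : τ ≤ t) :
    ∫ s in (0 : ℝ)..t, P.bang τ s = P.M * τ + P.m * (t - τ) := by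
  have hr := (P.admissible_bang τ).regular
  rw [← intervalIntegral.integral_add_adjacent_intervals (hr.intervalIntegrable_zero hτ)
    (hr.intervalIntegrable hτ (hτ.trans ht)), P.integral_bang_self hτ]
  have : ∫ s in τ..t, P.bang τ s = ∫ s in τ..t, P.m := by
    refine intervalIntegral.integral_congr fun s hs => ?_
    rw [uIcc_of_le ht] at hs
    exact bang_of_le hs.1
  rw [this, intervalIntegral.integral_const, smul_eq_mul]
  ring

/-- The value at `τ` of the switching function along `bang τ`, expressed through the two constant
controls; this form shows its continuity in `τ`. -/
theorem switching_bang_self (P : ScalarProblem) {τ : ℝ} (hτ : 0 ≤ τ) :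
    P.switching (P.bang τ) τ =
      Real.exp (-P.p * τ) * (P.γ - P.l * P.rest (fun _ => P.M) τ)
      + P.l ^ 2 * (Real.exp (-(P.l * (P.M - P.m) * τ)) * ∫ s in Ioi τ, P.flow (fun _ => P.m) s) := by
  have h1 : P.rest (P.bang τ) τ = P.rest (fun _ => P.M) τ := by
    rw [rest, rest, P.integral_bang_self hτ, intervalIntegral.integral_const, smul_eq_mul]
    ring_nf
  have h2 : ∫ s in Ioi τ, P.flow (P.bang τ) s
      = Real.exp (-(P.l * (P.M - P.m) * τ)) * ∫ s in Ioi τ, P.flow (fun _ => P.m) s := by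
    rw [← integral_const_mul]
    refine setIntegral_congr_fun measurableSet_Ioi fun s hs => ?_
    have hs' : τ ≤ s := le_of_lt hs
    have hr : P.rest (P.bang τ) s
        = Real.exp (-(P.l * (P.M - P.m) * τ)) * P.rest (fun _ => P.m) s := by
      rw [rest, rest, P.integral_bang_of_le hτ hs', intervalIntegral.integral_const, smul_eq_mul,
        mul_left_comm, ← Real.exp_add]
      ring_nf
    simp only [flow, bang_of_le hs', hr]
    ring
  rw [switching, h1, h2]

theorem exists_rest_const_le (P : ScalarProblem) :
    ∃ T, 0 ≤ T ∧ P.l * P.rest (fun _ => P.M) T ≤ P.γ := by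
  have h0 := (tendsto_rpow_mul_exp_neg_mul_atTop_nhds_zero 0 (P.l * P.M)
    (mul_pos P.l_pos (P.m_pos.trans P.m_lt_M))).const_mul (P.l * P.y0)
  simp only [Real.rpow_zero, one_mul, mul_zero] at h0
  obtain ⟨T, hT, hT0⟩ := ((h0.eventually_le_const P.γ_pos).and (eventually_ge_atTop 0)).exists
  refine ⟨T, hT0, le_trans ?_ hT⟩
  rw [rest, mul_assoc P.l]
  refine mul_le_mul_of_nonneg_left (mul_le_mul_of_nonneg_left (Real.exp_le_exp.2 ?_) P.y0_nonneg)
    P.l_pos.le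
  have := intervalIntegral.integral_nonneg (μ := volume) hT0 fun s hs => P.b_nonneg s hs.1
  rw [intervalIntegral.integral_const, smul_eq_mul]
  linarith

/-- There is a switching time at which the switching function of the corresponding bang-bang control
vanishes, unless this function is nonnegative already at time `0` for the switching time `0`. -/
theorem exists_switching_bang (P : ScalarProblem) :
    ∃ τ, 0 ≤ τ ∧ 0 ≤ P.switching (P.bang τ) τ ∧ (τ = 0 ∨ P.switching (P.bang τ) τ = 0) := by
  rcases le_or_gt 0 (P.switching (P.bang 0) 0) with h0 | h0
  · exact ⟨0, le_rfl, h0, Or.inl rfl⟩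
  obtain ⟨T, hT, hTγ⟩ := P.exists_rest_const_le
  have hm : P.Admissible fun _ => P.m := admissible_const ⟨le_rfl, P.m_lt_M.le⟩
  have hc : ContinuousOn (fun τ => P.switching (P.bang τ) τ) (Ici 0) := by
    have h : ContinuousOn (fun τ => Real.exp (-P.p * τ) * (P.γ - P.l * P.rest (fun _ => P.M) τ)
        + P.l ^ 2 * (Real.exp (-(P.l * (P.M - P.m) * τ)) *
          ((∫ s in Ioi 0, P.flow (fun _ => P.m) s)
            - ∫ s in (0 : ℝ)..τ, P.flow (fun _ => P.m) s))) (Ici 0) :=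
      (ContinuousOn.mul (by fun_prop) (continuousOn_const.sub
        (continuousOn_const.mul (continuousOn_rest (Regular.const P.M))))).add
      (continuousOn_const.mul (ContinuousOn.mul (by fun_prop) (continuousOn_const.sub
        (regular_flow hm.regular).continuousOn_primitive)))
    refine h.congr fun τ hτ => ?_
    rw [P.switching_bang_self hτ, integral_Ioi_flow_eq hm hτ]
  have hTnn : 0 ≤ P.switching (P.bang T) T := by
    rw [P.switching_bang_self hT]
    exact add_nonneg (mul_nonneg (Real.exp_pos _).le (sub_nonneg.2 hTγ))
      (mul_nonneg (sq_nonneg _) (mul_nonneg (Real.exp_pos _).le (integral_Ioi_flow_nonneg hm hT)))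
  obtain ⟨τ, hτ, hτ0⟩ := intermediate_value_Icc hT (hc.mono (Icc_subset_Ici_self : Icc 0 T ⊆ Ici 0))
    ⟨h0.le, hTnn⟩
  exact ⟨τ, hτ.1, hτ0.ge, Or.inr hτ0⟩

/-- Some control that switches at most once, from maximal to minimal, is optimal. -/
theorem exists_optimal_bang (P : ScalarProblem) :
    ∃ τ, ∀ v, P.Admissible v →
      ∫ s in Ioi 0, P.runCost (P.bang τ) s ≤ ∫ s in Ioi 0, P.runCost v s := by
  obtain ⟨τ, hτ, hσ, h0⟩ := P.exists_switching_bang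
  have hw := P.admissible_bang τ
  refine ⟨τ, fun v hv => integral_runCost_le hv hw fun t ht => ?_⟩
  have hvt := hv.mem_Icc t ht
  rcases lt_or_ge t τ with h | h
  · rw [bang_of_lt h]
    -- Here `τ > 0`, so the switching function vanishes at `τ`.
    have hz := h0.resolve_left (ht.trans_lt h).ne'
    exact mul_nonneg_of_nonpos_of_nonpos (switching_nonpos_of_le hw ht h.le hz)
      (sub_nonpos.2 hvt.2)
  · rw [bang_of_le h]
    exact mul_nonneg (switching_nonneg_of_le hw hτ h hσ) (sub_nonneg.2 hvt.1)

end ScalarProblem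

/-! ### Reduction of the game to the scalar problem -/

namespace ContentGame

variable {N : ℕ}

theorem IsTrajectory.one_sub_sum_eq {g : ContentGame N} {z : Fin N → ℝ} {u X : Fin N → ℝ → ℝ}
    (hu : ∀ j, u j ∈ g.strategies) (hX : g.IsTrajectory z u X) {t : ℝ} (ht : 0 ≤ t) :
    1 - ∑ j, X j t
      = (1 - ∑ j, z j) * Real.exp (-∫ s in (0 : ℝ)..t, ∑ j, g.lam j * u j s) := by
  have ha : Regular fun s => ∑ j, g.lam j * u j s :=
    Regular.sum _ fun j _ => (regular_of_mem_strategies (hu j)).const_mul _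
  have h := eq_of_deriv_zero
    (f := fun t => (1 - ∑ j, X j t) * Real.exp (∫ s in (0 : ℝ)..t, ∑ j, g.lam j * u j s))
    (countable_disc fun j => (hu j).1)
    ((continuousOn_const.sub (continuousOn_finsetSum _ fun j _ => hX.continuousOn j)).mul
      ha.continuousOn_primitive.rexp) (fun t ht hs => by
      have hc : ∀ j, ContinuousAt (u j) t := by
        by_contra h
        exact hs ⟨ht, h⟩
      have hca : ContinuousAt (fun s => ∑ j, g.lam j * u j s) t :=
        tendsto_finsetSum _ fun j _ => (hc j).const_mul _
      have h1 := ((HasDerivAt.fun_sum fun j (_ : j ∈ Finset.univ) =>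
        hX.hasDerivAt t ht hc j).const_sub 1).mul (ha.hasDerivAt_primitive ht hca).exp
      refine h1.congr_deriv ?_
      simp only [viewRate, ← Finset.sum_mul]
      ring) ht
  simp only [hX.initial, intervalIntegral.integral_same, Real.exp_zero, mul_one] at h
  rw [← h, mul_assoc, ← Real.exp_add, add_neg_cancel, Real.exp_zero, mul_one]

/-- The scalar control problem faced by player `i` when the other players use `u j`, `j ≠ i`. -/
noncomputable def scalarProblem (g : ContentGame N) (i : Fin N) (u : Fin N → ℝ → ℝ)
    (hu : ∀ j, j ≠ i → u j ∈ g.strategies) (z : Fin N → ℝ) (hz1 : ∑ j, z j ≤ 1) :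
    ScalarProblem where
  p := g.p i
  l := g.lam i
  γ := g.gam i
  m := g.umin
  M := g.umax
  y0 := 1 - ∑ j, z j
  b t := ∑ j ∈ Finset.univ.erase i, g.lam j * u j t
  p_pos := g.p_pos i
  l_pos := g.lam_pos i
  γ_pos := g.gam_pos i
  m_pos := zero_lt_one.trans_le g.one_le_umin
  m_lt_M := g.umin_lt_umax
  y0_nonneg := sub_nonneg.2 hz1
  regular_b := Regular.sum _ fun j hj =>
    (regular_of_mem_strategies (hu j (Finset.ne_of_mem_erase hj))).const_mul _
  b_nonneg t ht := Finset.sum_nonneg fun j hj => mul_nonneg (g.lam_pos j).le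
    ((zero_le_one.trans g.one_le_umin).trans ((hu j (Finset.ne_of_mem_erase hj)).2 t ht).1)

variable {g : ContentGame N} {i : Fin N} {u : Fin N → ℝ → ℝ}
  {hu : ∀ j, j ≠ i → u j ∈ g.strategies} {z : Fin N → ℝ} {hz1 : ∑ j, z j ≤ 1} {v : ℝ → ℝ}

theorem admissible_of_mem_strategies (hv : v ∈ g.strategies) :
    (g.scalarProblem i u hu z hz1).Admissible v :=
  ⟨regular_of_mem_strategies hv, hv.2⟩

theorem discountedRunningCost_eq (hu : ∀ j, j ≠ i → u j ∈ g.strategies) (hz1 : ∑ j, z j ≤ 1)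
    (hv : v ∈ g.strategies) {s : ℝ} (hs : 0 ≤ s) :
    g.discountedRunningCost i z (Function.update u i v) s
      = (g.scalarProblem i u hu z hz1).runCost v s := by
  have hup : ∀ j, Function.update u i v j ∈ g.strategies := by
    intro j
    rcases eq_or_ne j i with rfl | hj
    · simpa using hv
    · simpa [hj] using hu j hj
  have hint : ∫ r in (0 : ℝ)..s, ∑ j, g.lam j * Function.update u i v j r
      = g.lam i * (∫ r in (0 : ℝ)..s, v r)
        + ∫ r in (0 : ℝ)..s, (g.scalarProblem i u hu z hz1).b r := by
    rw [← intervalIntegral.integral_const_mul, ← intervalIntegral.integral_add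
      (((regular_of_mem_strategies hv).const_mul _).intervalIntegrable_zero hs)
      ((g.scalarProblem i u hu z hz1).regular_b.intervalIntegrable_zero hs)]
    refine intervalIntegral.integral_congr fun r _ => ?_
    simp only [scalarProblem, ← Finset.add_sum_erase _ _ (Finset.mem_univ i),
      Function.update_self]
    congr 1
    exact Finset.sum_congr rfl fun j hj => by
      rw [Function.update_of_ne (Finset.ne_of_mem_erase hj)]
  have hrest := (g.isTrajectory_trajectory z hup).one_sub_sum_eq hup hs
  rw [hint] at hrest
  simp only [discountedRunningCost, viewRate, hrest, Function.update_self,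
    ScalarProblem.runCost, ScalarProblem.rest, scalarProblem, neg_mul]

theorem cost_update_eq (hu : ∀ j, j ≠ i → u j ∈ g.strategies) (hz1 : ∑ j, z j ≤ 1)
    (hv : v ∈ g.strategies) :
    g.cost i z (Function.update u i v)
      = ∫ s in Ioi 0, (g.scalarProblem i u hu z hz1).runCost v s :=
  setIntegral_congr_fun measurableSet_Ioi fun _ hs =>
    discountedRunningCost_eq hu hz1 hv (le_of_lt hs)

end ContentGame

theorem mainTheorem1 {N : ℕ} (g : ContentGame N) (i : Fin N) (u : Fin N → ℝ → ℝ)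
    (hu : ∀ j, j ≠ i → u j ∈ g.strategies)
    (z : Fin N → ℝ) (hz : ∀ j, 0 ≤ z j) (hz1 : ∑ j, z j ≤ 1) :
    (∀ v ∈ g.strategies,
      IntegrableOn (g.discountedRunningCost i z (Function.update u i v)) (Set.Ioi 0)) ∧
    ∃ w ∈ g.strategies, g.IsBangBang w ∧
      g.cost i z (Function.update u i w) = g.value i u z ∧
      ∀ v ∈ g.strategies,
        g.cost i z (Function.update u i w) ≤ g.cost i z (Function.update u i v) := by
  set P := g.scalarProblem i u hu z hz1
  refine ⟨fun v hv => ?_, ?_⟩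
  · refine (P.integrableOn_runCost (ContentGame.admissible_of_mem_strategies hv)).congr_fun
      (fun s hs => ?_) measurableSet_Ioi
    exact (ContentGame.discountedRunningCost_eq hu hz1 hv (le_of_lt hs)).symm
  obtain ⟨τ, hτ⟩ := P.exists_optimal_bang
  have hw : P.bang τ ∈ g.strategies := ⟨P.piecewiseContinuous_bang τ, fun t _ => P.bang_mem τ t⟩
  have hle : ∀ v ∈ g.strategies,
      g.cost i z (Function.update u i (P.bang τ)) ≤ g.cost i z (Function.update u i v) := by
    intro v hv
    rw [ContentGame.cost_update_eq hu hz1 hw, ContentGame.cost_update_eq hu hz1 hv]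
    exact hτ v (ContentGame.admissible_of_mem_strategies hv)
  refine ⟨P.bang τ, hw, fun t _ => ?_, ?_, hle⟩
  · rcases lt_or_ge t τ with h | h
    · exact Or.inr (ScalarProblem.bang_of_lt h)
    · exact Or.inl (ScalarProblem.bang_of_le h)
  · have hleast : IsLeast ((fun v => g.cost i z (Function.update u i v)) '' g.strategies)
        (g.cost i z (Function.update u i (P.bang τ))) := by
      refine ⟨mem_image_of_mem _ hw, ?_⟩
      rintro _ ⟨v, hv, rfl⟩
      exact hle v hv
    exact hleast.csInf_eq.symm
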